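/- Let $(W,S)$ be an irreducible Coxeter system of affine type, that is: its Coxeter diagram is connected, $S$ is finite, and $W$ is infinite and virtually abelian. Order $W$ by $v\le w$ if and only if some geodesic path from $e$ to $w$ in the Cayley graph $\mathrm{Cay}(W,S)$ passes through $v$. A sequence $(w_i)_{i\in\mathbb N}$ in $W$ is called convergent if for every $v\in W$ either $v\le w_i$ for all large $i$ (written $v\le (w_i)_i$) or $v\not\le w_i$ for all large $i$. Let $\overline{(W,S)}$ be the set of convergent sequences modulo the identification of sequences $\mathbf x,\mathbf y$ with $v\le\mathbf x\Leftrightarrow v\le\mathbf y$ for all $v\in W$, with the topology generated by the sets $\{z\mid v\le z\}$ and $\{z\mid v\not\le z\}$, $v\in W$; it contains $W$ as the classes of the constant sequences. The system $(W,S)$ is called small at infinity if for every net $(g_i)$ in $W$ converging to a point $z\in\overline{(W,S)}\setminus W$ and every $g\in W$, one has $g_ig\to z$. Then $(W,S)$ is small at infinity if and only if it is the infinite dihedral system, i.e. $S=\{s,t\}$ with $s\neq t$ and $m_{st}=\infty$; equivalently, if and only if $W$ is isomorphic, as a group, to the infinite dihedral group. Moreover, if $|S|\geq 3$, then there is a generator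 $s\in S$ that commutes with an element of infinite order lying in an abelian normal subgroup of finite index in $W$ (a non-trivial translation); in particular the centralizer $C_W(s)=\{w\in W\mid sw=ws\}$ is infinite. -/

import Mathlib

open Filter Topology

namespace RootedGraph

variable {V : Type*}

/-- The graph order of the graph `G` with root `o`: `x` lies below `y` if some geodesic path
from `o` to `y` passes through `x`. -/
def Below (G : SimpleGraph V) (o x y : V) : Prop :=
  ∃ p : G.Walk o y, p.length = G.dist o y ∧ x ∈ p.support

/-- A sequence `o`-converges if every vertex is either below all but finitely many of its terms,
or below only finitely many of them. -/
def OConverges (G : SimpleGraph V) (o : V) (u : ℕ → V) : Prop :=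
  ∀ x : V, (∀ᶠ i in atTop, Below G o x (u i)) ∨ (∀ᶠ i in atTop, ¬ Below G o x (u i))

/-- Two `o`-convergent sequences are equivalent if the same vertices are eventually below them. -/
def oSetoid (G : SimpleGraph V) (o : V) : Setoid {u : ℕ → V // OConverges G o u} where
  r u v := ∀ x : V,
    (∀ᶠ i in atTop, Below G o x (u.1 i)) ↔ (∀ᶠ i in atTop, Below G o x (v.1 i))
  iseqv :=
    { refl := fun _ _ => Iff.rfl
      symm := fun h x => (h x).symm
      trans := fun h k x => (h x).trans (k x) }

/-- The bordification of the rooted graph `(G, o)`: the equivalence classes of all `o`-convergent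
sequences of vertices. -/
def Bordification (G : SimpleGraph V) (o : V) : Type _ :=
  Quotient (oSetoid G o)

/-- The class of the constant sequence at a vertex. -/
def vertex (G : SimpleGraph V) (o : V) (x : V) : Bordification G o :=
  Quotient.mk (oSetoid G o) ⟨fun _ => x, fun y => by
    by_cases h : Below G o y x
    · exact Or.inl (Eventually.of_forall fun _ => h)
    · exact Or.inr (Eventually.of_forall fun _ => h)⟩

/-- The relation `x ≤ z` between a vertex `x` and a point `z` of the bordification:
`x` is eventually below the sequences representing `z`. -/
def BelowPoint (G : SimpleGraph V) (o : V) (x : V) (z : Bordification G o) : Prop :=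
  Quotient.lift (fun u : {u : ℕ → V // OConverges G o u} => ∀ᶠ i in atTop, Below G o x (u.1 i))
    (fun u v h => propext ((show (oSetoid G o).r u v from h) x)) z

/-- The topology of the bordification is generated by the sets `{z | x ≤ z}` and their
complements. -/
instance (G : SimpleGraph V) (o : V) : TopologicalSpace (Bordification G o) :=
  TopologicalSpace.generateFrom
    {U | ∃ x : V, U = {z | BelowPoint G o x z} ∨ U = {z | ¬ BelowPoint G o x z}}

end RootedGraph

/-- A compactification `j : G → X` of a group is small at infinity if for every `z` in `X` outside
the image of `G` and every `h` in `G`, whenever `g` tends to `z` so does `g * h`. Convergence of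
nets `(gᵢ)` in `G` is expressed by their eventuality filters `l` on `G`. -/
def IsSmallAtInfinity {G X : Type*} [Group G] [TopologicalSpace X] (j : G → X) : Prop :=
  ∀ z : X, z ∉ Set.range j → ∀ (l : Filter G), Tendsto j l (𝓝 z) →
    ∀ h : G, Tendsto (fun g => j (g * h)) l (𝓝 z)

/-- A group is virtually abelian if it has an abelian subgroup of finite index. -/
def IsVirtuallyAbelian (G : Type*) [Group G] : Prop :=
  ∃ A : Subgroup G, A.FiniteIndex ∧ ∀ a ∈ A, ∀ b ∈ A, a * b = b * a

/-- The Coxeter diagram without its labels: distinct `i`, `j` are joined if their exponent is at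
least `3` or infinite. (In `CoxeterMatrix`, the exponent `∞` is encoded as `0`.) -/
def CoxeterMatrix.diagram {B : Type*} (M : CoxeterMatrix B) : SimpleGraph B where
  Adj i j := i ≠ j ∧ (3 ≤ M i j ∨ M i j = 0)
  symm := ⟨fun i j h => by rw [M.symmetric j i]; exact ⟨h.1.symm, h.2⟩⟩
  loopless := ⟨fun _ h => h.1 rfl⟩

namespace CoxeterSystem

variable {B W : Type*} [Group W] {M : CoxeterMatrix B}

/-- The Cayley graph of `W` with respect to the simple generators. -/
def cayleyGraph (cs : CoxeterSystem M W) : SimpleGraph W :=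
  SimpleGraph.mulCayley (Set.range cs.simple)

/-- The Coxeter system is small at infinity: the compactification of its Cayley graph, rooted at
the neutral element, is small at infinity. -/
def SmallAtInfinity (cs : CoxeterSystem M W) : Prop :=
  IsSmallAtInfinity (RootedGraph.vertex cs.cayleyGraph (1 : W))

/-- Irreducible Coxeter systems of affine type. -/
structure IsIrreducibleAffine (_cs : CoxeterSystem M W) : Prop where
  irreducible : M.diagram.Connected
  finite_rank : Finite B
  infinite : Infinite W
  virtuallyAbelian : IsVirtuallyAbelian W

/-- The Coxeter system is the infinite dihedral one, `⟨s, t | s² = t² = 1⟩`: there are exactly two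
generators, and their exponent is infinite. -/
def IsInfiniteDihedral (_cs : CoxeterSystem M W) : Prop :=
  ∃ i j : B, i ≠ j ∧ (∀ k : B, k = i ∨ k = j) ∧ M i j = 0

end CoxeterSystem

/-!
In rank at least three, a simple reflection `s` with infinite centralizer is found as follows. Let
`A` be an abelian normal subgroup of finite index. For `a` in `A` the element `a * (s a s)` of `A`
is fixed by `s`. If all these elements, for all `s`, have finite order, then for some `n > 0` every
simple reflection inverts all powers `a ^ n`. This contradicts that `W` is infinite and has a third
generator:

* If some exponent `m(s, t)` is infinite, some power `(s t) ^ k` with `k > 0` is inverted by a third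
  simple reflection `u`. The geometric representation excludes this
  (`CoxeterSystem.simple_mul_pow_mul_simple_ne`), because `s t` acts on the plane spanned by the
  roots of `s` and `t` as a unipotent element. The representation need not be known to be faithful.
* If all exponents are finite, the powers `a ^ n` are central in the subgroup of words of even
  length. The transfer from that subgroup to `A` has torsion values on its generators `s t`, hence
  everywhere, but it is a power map on `a ^ (2 * n)`. So `A` is a finitely generated torsion group
  and `W` is finite (`CoxeterSystem.isOfFinOrder_of_forall_inverted`).

A simple reflection `s` with infinite centralizer prevents smallness at infinity: a sequence of
distinct elements `g` commuting with `s` has a subsequence converging to some `z` at infinity, and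
exactly one of `g` and `g s = s g` is above `s`, so `g s` does not converge to `z`. It also prevents
`W` from being the infinite dihedral group, where involutions have finite centralizers. What remains
is rank at most two, where `W` is infinite only for the infinite dihedral system. The Cayley graph
of that system is a line, on which right multiplication moves points by a bounded distance.
-/

/-! ### Cayley graphs and their bordifications -/

namespace RootedGraph

variable {V : Type*} {G : SimpleGraph V} {o : V}

theorem belowPoint_vertex {x y : V} : BelowPoint G o x (vertex G o y) ↔ Below G o x y :=
  show (∀ᶠ _ in (atTop : Filter ℕ), Below G o x y) ↔ _ from eventually_const

theorem Bordification.ext {z z' : Bordification G o}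
    (h : ∀ x, BelowPoint G o x z ↔ BelowPoint G o x z') : z = z' := by
  induction z using Quotient.inductionOn with | _ u
  induction z' using Quotient.inductionOn with | _ u'
  exact Quotient.sound h

/-- Convergence to a point of the bordification is tested on one vertex at a time. -/
theorem tendsto_vertex_iff {α : Type*} {f : α → V} {l : Filter α} {z : Bordification G o} :
    Tendsto (fun a => vertex G o (f a)) l (𝓝 z) ↔
      ∀ x, ∀ᶠ a in l, (Below G o x (f a) ↔ BelowPoint G o x z) := by
  rw [TopologicalSpace.tendsto_nhds_generateFrom_iff]
  constructor
  · intro h x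
    by_cases hx : BelowPoint G o x z
    · filter_upwards [h {z | BelowPoint G o x z} ⟨x, Or.inl rfl⟩ hx] with a ha
      exact iff_of_true (belowPoint_vertex.1 ha) hx
    · filter_upwards [h {z | ¬ BelowPoint G o x z} ⟨x, Or.inr rfl⟩ hx] with a ha
      exact iff_of_false (fun h => ha (belowPoint_vertex.2 h)) hx
  · rintro h U ⟨x, rfl | rfl⟩ hz
    · filter_upwards [h x] with a ha
      exact belowPoint_vertex.2 (ha.2 hz)
    · filter_upwards [h x] with a ha
      exact fun hb => hz (ha.1 (belowPoint_vertex.1 hb))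

/-- Over a countable vertex set every sequence of vertices has an `o`-convergent subsequence, since
the sets of vertices form a compact metrizable space. -/
theorem exists_subseq_oConverges [Countable V] (G : SimpleGraph V) (o : V) (u : ℕ → V) :
    ∃ φ : ℕ → ℕ, StrictMono φ ∧ OConverges G o (u ∘ φ) := by
  classical
  obtain ⟨b, φ, hφ, hb⟩ :=
    CompactSpace.tendsto_subseq (fun n x => decide (Below G o x (u n)) : ℕ → V → Bool)
  refine ⟨φ, hφ, fun x => ?_⟩
  have hx := tendsto_pi_nhds.1 hb x
  rw [nhds_discrete, tendsto_pure] at hx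
  cases hbx : b x
  · exact Or.inr (hx.mono fun n hn => by simpa [hbx] using hn)
  · exact Or.inl (hx.mono fun n hn => by simpa [hbx] using hn)

/-- A family of vertices that converges to a point at infinity leaves every vertex. -/
theorem eventually_ne_of_tendsto_vertex {α : Type*} {f : α → V} {l : Filter α}
    {z : Bordification G o} (hz : z ∉ Set.range (vertex G o))
    (h : Tendsto (fun a => vertex G o (f a)) l (𝓝 z)) (y : V) : ∀ᶠ a in l, f a ≠ y := by
  by_contra hy
  refine hz ⟨y, Bordification.ext fun x => ?_⟩
  rw [tendsto_vertex_iff] at h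
  by_contra hx
  refine hy ((h x).mono fun a ha hay => hx ?_)
  rw [belowPoint_vertex, ← hay, ha]

end RootedGraph

namespace CoxeterSystem

open RootedGraph

variable {B W : Type*} [Group W] {M : CoxeterMatrix B} (cs : CoxeterSystem M W)

theorem simple_ne_one (i : B) : cs.simple i ≠ 1 := fun h => by
  simpa [h] using cs.length_simple i

theorem cayleyGraph_adj {x y : W} : cs.cayleyGraph.Adj x y ↔ ∃ i, y = x * cs.simple i := by
  rw [cayleyGraph, SimpleGraph.mulCayley_adj']
  constructor
  · rintro ⟨-, _, ⟨i, rfl⟩, h | h⟩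
    · exact ⟨i, h.symm⟩
    · exact ⟨i, by rw [h, simple_mul_simple_cancel_right]⟩
  · rintro ⟨i, rfl⟩
    exact ⟨by simp [cs.simple_ne_one i], _, ⟨i, rfl⟩, Or.inl rfl⟩

theorem length_inv_mul_le_length_walk {x y : W} (p : cs.cayleyGraph.Walk x y) :
    cs.length (x⁻¹ * y) ≤ p.length := by
  induction p with
  | nil => simp
  | @cons u v w h p ih =>
    obtain ⟨i, rfl⟩ := cs.cayleyGraph_adj.1 h
    have h1 := cs.length_mul_le (cs.simple i) ((u * cs.simple i)⁻¹ * w)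
    rw [length_simple, mul_inv_rev, inv_simple, mul_assoc, simple_mul_simple_cancel_left] at h1
    rw [mul_inv_rev, inv_simple, mul_assoc] at ih
    rw [SimpleGraph.Walk.length_cons]
    omega

theorem exists_walk_length_eq_length_wordProd (ω : List B) (x : W) :
    ∃ p : cs.cayleyGraph.Walk x (x * cs.wordProd ω), p.length = ω.length := by
  induction ω generalizing x with
  | nil => exact ⟨SimpleGraph.Walk.nil.copy rfl (by simp), by simp⟩
  | cons i ω ih =>
    obtain ⟨p, hp⟩ := ih (x * cs.simple i)
    refine ⟨(SimpleGraph.Walk.cons (cs.cayleyGraph_adj.2 ⟨i, rfl⟩) p).copy rfl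
      (by rw [wordProd_cons, mul_assoc]), by simp [hp]⟩

theorem exists_walk_length_eq (x y : W) :
    ∃ p : cs.cayleyGraph.Walk x y, p.length = cs.length (x⁻¹ * y) := by
  obtain ⟨ω, hω, hxy⟩ := cs.exists_isReduced (x⁻¹ * y)
  obtain ⟨p, hp⟩ := cs.exists_walk_length_eq_length_wordProd ω x
  exact ⟨p.copy rfl (by rw [← hxy, mul_inv_cancel_left]), by
    rw [SimpleGraph.Walk.length_copy, hp, hxy, hω.eq]⟩

theorem cayleyGraph_dist (x y : W) : cs.cayleyGraph.dist x y = cs.length (x⁻¹ * y) := by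
  obtain ⟨p, hp⟩ := cs.exists_walk_length_eq x y
  refine le_antisymm (hp ▸ SimpleGraph.dist_le p) ?_
  obtain ⟨q, hq⟩ := SimpleGraph.Reachable.exists_walk_length_eq_dist ⟨p⟩
  exact hq ▸ cs.length_inv_mul_le_length_walk q

/-- The graph order of the Cayley graph is the right weak order. -/
theorem below_iff {x y : W} :
    Below cs.cayleyGraph 1 x y ↔ cs.length x + cs.length (x⁻¹ * y) = cs.length y := by
  have hle := cs.length_mul_le x (x⁻¹ * y)
  rw [mul_inv_cancel_left] at hle
  rw [Below, cayleyGraph_dist, inv_one, one_mul]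
  constructor
  · rintro ⟨p, hp, hx⟩
    obtain ⟨q, r, rfl⟩ := SimpleGraph.Walk.mem_support_iff_exists_append.1 hx
    have hq := cs.length_inv_mul_le_length_walk q
    have hr := cs.length_inv_mul_le_length_walk r
    rw [SimpleGraph.Walk.length_append] at hp
    rw [inv_one, one_mul] at hq
    omega
  · intro h
    obtain ⟨q, hq⟩ := cs.exists_walk_length_eq 1 x
    obtain ⟨r, hr⟩ := cs.exists_walk_length_eq x y
    rw [inv_one, one_mul] at hq
    exact ⟨q.append r, by rw [SimpleGraph.Walk.length_append, hq, hr, h],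
      SimpleGraph.Walk.mem_support_iff_exists_append.2 ⟨q, r, rfl⟩⟩

/-- Exactly one of `w` and `s w` has the simple reflection `s` below it. -/
theorem below_simple_mul_iff (i : B) (w : W) :
    Below cs.cayleyGraph 1 (cs.simple i) (cs.simple i * w) ↔
      ¬ Below cs.cayleyGraph 1 (cs.simple i) w := by
  rw [below_iff, below_iff, inv_simple, simple_mul_simple_cancel_left, length_simple]
  have := cs.length_simple_mul w i
  omega

/-- An element strictly above `x` is above some upper neighbour of `x`. -/
theorem exists_below_mul_simple {x y : W} (h : Below cs.cayleyGraph 1 x y) (hxy : y ≠ x) :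
    ∃ i, Below cs.cayleyGraph 1 (x * cs.simple i) y ∧
      ¬ Below cs.cayleyGraph 1 (x * cs.simple i) x := by
  obtain ⟨i, hi⟩ := cs.exists_leftDescent_of_ne_one
    (w := x⁻¹ * y) (fun h => hxy (inv_mul_eq_one.1 h).symm)
  rw [isLeftDescent_iff] at hi
  rw [below_iff] at h
  have h1 := cs.length_mul_le (x * cs.simple i) (cs.simple i * (x⁻¹ * y))
  have h2 := cs.length_mul_simple x i
  rw [mul_assoc, simple_mul_simple_cancel_left, mul_inv_cancel_left] at h1
  refine ⟨i, ?_, ?_⟩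
  · rw [below_iff, mul_inv_rev, inv_simple, mul_assoc]
    omega
  · rw [below_iff]
    omega

theorem countable (cs : CoxeterSystem M W) [Countable B] : Countable W :=
  cs.wordProd_surjective.countable

/-- A convergent sequence of distinct elements converges to a point at infinity: its limit is not
an element `x` of `W`, as all but finitely many terms would be above `x`, and by the pigeonhole
principle infinitely many of them above the same upper neighbour of `x`. -/
theorem mk_notMem_range_vertex [Finite B] {u : ℕ → W} (hu : Function.Injective u)
    (hc : OConverges cs.cayleyGraph 1 u) :
    (Quotient.mk (oSetoid cs.cayleyGraph 1) ⟨u, hc⟩ : Bordification cs.cayleyGraph 1) ∉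
      Set.range (vertex cs.cayleyGraph 1) := by
  rintro ⟨x, hx⟩
  have key (v : W) : (∀ᶠ n in atTop, Below cs.cayleyGraph 1 v (u n)) ↔
      Below cs.cayleyGraph 1 v x := by
    rw [← belowPoint_vertex, hx]; rfl
  have h1 : ∀ᶠ n in atTop, Below cs.cayleyGraph 1 x (u n) := by
    rw [key, below_iff]; simp
  have h2 : ∀ᶠ n in atTop, ∀ i, ¬ Below cs.cayleyGraph 1 (x * cs.simple i) x →
      ¬ Below cs.cayleyGraph 1 (x * cs.simple i) (u n) := by
    rw [eventually_all]
    intro i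
    rcases hc (x * cs.simple i) with h | h
    · exact Eventually.of_forall fun n hn => absurd ((key _).1 h) hn
    · exact h.mono fun n hn _ => hn
  have h3 : ∀ᶠ n in atTop, u n ≠ x := by
    rw [← Nat.cofinite_eq_atTop]
    exact hu.tendsto_cofinite.eventually (eventually_cofinite_ne x)
  obtain ⟨n, h1, h2, h3⟩ := (h1.and (h2.and h3)).exists
  obtain ⟨i, hi, hi'⟩ := cs.exists_below_mul_simple h1 h3
  exact h2 i hi' hi

/-- If `s` commutes with infinitely many elements, a sequence of those converges to some point `z`
at infinity. Multiplying it by `s` on the right is multiplying it by `s` on the left, and that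
changes whether `s ≤ z`. -/
theorem not_smallAtInfinity_of_infinite_centralizer [Finite B] {i : B}
    (h : {w : W | cs.simple i * w = w * cs.simple i}.Infinite) : ¬ cs.SmallAtInfinity := by
  intro hs
  have := cs.countable
  let u : ℕ → W := fun n => h.natEmbedding _ n
  have hu : Function.Injective u := Subtype.val_injective.comp (h.natEmbedding _).injective
  obtain ⟨φ, hφ, hc⟩ := exists_subseq_oConverges cs.cayleyGraph 1 u
  let z : Bordification cs.cayleyGraph 1 := Quotient.mk (oSetoid cs.cayleyGraph 1) ⟨u ∘ φ, hc⟩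
  have hz : z ∉ Set.range (vertex cs.cayleyGraph 1) :=
    cs.mk_notMem_range_vertex (hu.comp hφ.injective) hc
  have hlim : Tendsto (vertex cs.cayleyGraph 1) (map (u ∘ φ) atTop) (𝓝 z) := by
    rw [tendsto_map'_iff]
    refine tendsto_vertex_iff.2 fun x => ?_
    change ∀ᶠ n in atTop, (_ ↔ ∀ᶠ n in atTop, Below cs.cayleyGraph 1 x ((u ∘ φ) n))
    rcases hc x with hx | hx
    · exact hx.mono fun n hn => iff_of_true hn hx
    · exact hx.mono fun n hn => iff_of_false hn fun h => by
        obtain ⟨m, hm, hm'⟩ := (h.and hx).exists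
        exact hm' hm
  have hlim' := hs z hz _ hlim (cs.simple i)
  have h1 := eventually_map.1 (tendsto_vertex_iff.1 hlim (cs.simple i))
  have h2 := eventually_map.1 (tendsto_vertex_iff.1 hlim' (cs.simple i))
  obtain ⟨n, h1, h2⟩ := (h1.and h2).exists
  have hn : cs.simple i * u (φ n) = u (φ n) * cs.simple i := (h.natEmbedding _ (φ n)).2
  rw [Function.comp_apply, ← hn, below_simple_mul_iff] at h2
  exact iff_not_self (h1.trans h2.symm)

end CoxeterSystem

/-! ### The geometric representation -/

/-- A product of two reflections whose axes enclose the angle `π / m` has order dividing `m`. -/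
theorem Module.reflection_mul_reflection_pow_eq_one {V : Type*} [AddCommGroup V] [Module ℝ V]
    {x y : V} {f g : Module.Dual ℝ V} (hf : f x = 2) (hg : g y = 2) {m : ℕ} (hm : 2 ≤ m)
    (hx : g x = -2 * Real.cos (Real.pi / m)) (hy : f y = -2 * Real.cos (Real.pi / m)) :
    (Module.reflection hf * Module.reflection hg) ^ m = 1 := by
  ext z
  rw [LinearEquiv.coe_one, id]
  rcases hm.eq_or_lt with rfl | hm
  · have h0 : Real.cos (Real.pi / (2 : ℕ)) = 0 := by simp
    rw [h0, mul_zero] at hx hy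
    simp [pow_two, Module.reflection_apply, hf, hg, hx, hy]
    module
  -- The trace of the product on the plane spanned by `x` and `y` is `2 cos θ`.
  set θ : ℝ := 2 * Real.pi / m with hθ
  have ht : 2 * Real.cos θ = f y * g x - 2 := by
    rw [hx, hy, hθ, mul_div_assoc, Real.cos_two_mul]; ring
  have hsin : Real.sin θ ≠ 0 := by
    refine (Real.sin_pos_of_pos_of_lt_pi (by positivity) ?_).ne'
    rw [hθ, div_lt_iff₀ (by positivity), mul_comm]
    exact mul_lt_mul_of_pos_left (by exact_mod_cast hm) Real.pi_pos
  have hS (n : ℤ) : (Polynomial.Chebyshev.S ℝ n).eval (2 * Real.cos θ) =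
      Real.sin ((n + 1) * θ) / Real.sin θ := by
    rw [eq_div_iff hsin, Polynomial.Chebyshev.S_two_mul_real_cos]
  rw [Module.reflection_mul_reflection_pow_apply hf hg m z _ ht]
  obtain ⟨k, rfl | rfl⟩ := m.even_or_odd'
  · have hk0 : (k : ℝ) ≠ 0 := by exact_mod_cast (by omega : k ≠ 0)
    have e1 : (((2 * k : ℕ) : ℤ) - 2) / 2 = k - 1 := by omega
    have e2 : (((2 * k : ℕ) : ℤ) - 1) / 2 = k - 1 := by omega
    have hk : (Polynomial.Chebyshev.S ℝ (k - 1)).eval (2 * Real.cos θ) = 0 := by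
      have : (((k - 1 : ℤ) : ℝ) + 1) * θ = Real.pi := by
        rw [hθ]; push_cast; field_simp; ring
      rw [hS, this, Real.sin_pi, zero_div]
    rw [e1, e2, hk]
    simp
  · have e1 : (((2 * k + 1 : ℕ) : ℤ) - 2) / 2 = k - 1 := by omega
    have e2 : (((2 * k + 1 : ℕ) : ℤ) - 1) / 2 = k := by omega
    have e3 : (((2 * k + 1 : ℕ) : ℤ) - 3) / 2 = k - 1 := by omega
    have e4 : ((2 * k + 1 : ℕ) : ℤ) / 2 = k := by omega
    have hk : (Polynomial.Chebyshev.S ℝ k).eval (2 * Real.cos θ) +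
        (Polynomial.Chebyshev.S ℝ (k - 1)).eval (2 * Real.cos θ) = 0 := by
      have : (((k - 1 : ℤ) : ℝ) + 1) * θ = 2 * Real.pi - (((k : ℤ) : ℝ) + 1) * θ := by
        have hk0 : (2 * k + 1 : ℝ) ≠ 0 := by positivity
        rw [hθ]; push_cast; field_simp; ring
      rw [hS, hS, this, Real.sin_two_pi_sub, neg_div, add_neg_cancel]
    rw [e1, e2, e3, e4, hk]
    simp

namespace CoxeterMatrix

variable {B : Type*} (M : CoxeterMatrix B)

/-- The linear form that pairs a vector with the `i`-th simple root, scaled to take the value `2`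
there. Vectors are written in the basis of simple roots, and the roots `i` and `j` pair to
`-cos (π / M i j)` before scaling. An exponent `∞`, encoded
as `0`, gives the value `-2` at the `j`-th simple root, as it should, because
division by `0` yields `cos (π / 0) = cos 0 = 1`. -/
noncomputable def simpleCoroot (i : B) : Module.Dual ℝ (B →₀ ℝ) :=
  Finsupp.linearCombination ℝ fun j => -2 * Real.cos (Real.pi / M i j)

theorem simpleCoroot_single (i j : B) :
    M.simpleCoroot i (Finsupp.single j 1) = -2 * Real.cos (Real.pi / M i j) := by
  simp [simpleCoroot]

theorem simpleCoroot_single_self (i : B) : M.simpleCoroot i (Finsupp.single i 1) = 2 := by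
  simp [simpleCoroot_single]

theorem simpleCoroot_single_of_eq_zero {i j : B} (h : M i j = 0) :
    M.simpleCoroot i (Finsupp.single j 1) = -2 := by
  simp [simpleCoroot_single, h]

theorem simpleCoroot_single_nonpos {i j : B} (h : i ≠ j) :
    M.simpleCoroot i (Finsupp.single j 1) ≤ 0 := by
  rw [simpleCoroot_single]
  have h1 : M i j ≠ 1 := M.off_diagonal i j h
  have : 0 ≤ Real.cos (Real.pi / M i j) := by
    rcases Nat.eq_zero_or_pos (M i j) with h0 | h0
    · simp [h0]
    · have h2 : (2 : ℝ) ≤ M i j := by exact_mod_cast (by omega : 2 ≤ M i j)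
      have hpi := Real.pi_pos
      refine Real.cos_nonneg_of_neg_pi_div_two_le_of_le ?_ ?_
      · have : 0 ≤ Real.pi / M i j := by positivity
        linarith
      · exact div_le_div_of_nonneg_left hpi.le two_pos h2
  linarith

theorem isLiftable_reflection :
    M.IsLiftable fun i => Module.reflection (M.simpleCoroot_single_self i) := by
  intro i j
  rcases eq_or_ne i j with rfl | h
  · rw [M.diagonal, pow_one]
    exact LinearEquiv.ext (Module.involutive_reflection (M.simpleCoroot_single_self i))
  rcases Nat.eq_zero_or_pos (M i j) with h0 | h0
  · rw [h0, pow_zero]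
  · have h1 : M i j ≠ 1 := M.off_diagonal i j h
    refine Module.reflection_mul_reflection_pow_eq_one _ _ (by omega) ?_
      (M.simpleCoroot_single i j)
    rw [simpleCoroot_single, M.symmetric]

end CoxeterMatrix

namespace CoxeterSystem

variable {B W : Type*} [Group W] {M : CoxeterMatrix B} (cs : CoxeterSystem M W)

/-- The geometric representation of a Coxeter group: the basis vectors are the simple roots, and
the simple generators act as the reflections in them. -/
noncomputable def geomRep : W →* ((B →₀ ℝ) ≃ₗ[ℝ] (B →₀ ℝ)) :=
  cs.lift ⟨_, M.isLiftable_reflection⟩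

theorem geomRep_simple (i : B) (v : B →₀ ℝ) :
    cs.geomRep (cs.simple i) v = v - M.simpleCoroot i v • Finsupp.single i 1 := by
  rw [geomRep, lift_apply_simple, Module.reflection_apply]

theorem geomRep_simple_mul_simple_pow_add {i j : B} (h : M i j = 0) (n : ℕ) :
    cs.geomRep ((cs.simple i * cs.simple j) ^ n) (Finsupp.single i 1 + Finsupp.single j 1) =
      Finsupp.single i 1 + Finsupp.single j 1 := by
  induction n with
  | zero => simp
  | succ n ih =>
    rw [pow_succ', map_mul, LinearEquiv.mul_apply, ih, map_mul, LinearEquiv.mul_apply]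
    simp only [geomRep_simple, map_add, map_sub, map_smul, M.simpleCoroot_single_self,
      M.simpleCoroot_single_of_eq_zero h,
      M.simpleCoroot_single_of_eq_zero (M.symmetric i j ▸ h : M j i = 0)]
    module

/-- If the exponent is infinite, the product of the two reflections is unipotent. -/
theorem geomRep_simple_mul_simple_pow {i j : B} (h : M i j = 0) (n : ℕ) :
    cs.geomRep ((cs.simple i * cs.simple j) ^ n) (Finsupp.single i 1) =
      Finsupp.single i 1 + (2 * n : ℝ) • (Finsupp.single i 1 + Finsupp.single j 1) := by
  have h1 : cs.geomRep (cs.simple i * cs.simple j) (Finsupp.single i 1) =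
      Finsupp.single i 1 + (2 : ℝ) • (Finsupp.single i 1 + Finsupp.single j 1) := by
    rw [map_mul, LinearEquiv.mul_apply]
    simp only [geomRep_simple, map_sub, map_smul, M.simpleCoroot_single_self,
      M.simpleCoroot_single_of_eq_zero h,
      M.simpleCoroot_single_of_eq_zero (M.symmetric i j ▸ h : M j i = 0)]
    module
  induction n with
  | zero => simp
  | succ n ih =>
    rw [pow_succ, map_mul, LinearEquiv.mul_apply, h1, map_add, map_smul, ih,
      cs.geomRep_simple_mul_simple_pow_add h]
    push_cast
    module

/-- Words in `s_i` and `s_j` change only the `i`-th and the `j`-th coordinate of a vector. -/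
theorem geomRep_simple_mul_simple_pow_apply {i j k : B} (hi : i ≠ k) (hj : j ≠ k) (n : ℕ)
    (v : B →₀ ℝ) : cs.geomRep ((cs.simple i * cs.simple j) ^ n) v k = v k := by
  induction n with
  | zero => simp
  | succ n ih =>
    rw [pow_succ', map_mul, LinearEquiv.mul_apply, map_mul, LinearEquiv.mul_apply]
    simp only [geomRep_simple]
    simp [Finsupp.single_eq_of_ne hi.symm, Finsupp.single_eq_of_ne hj.symm, -map_pow, -map_mul, ih]

/-- No simple reflection `s_k` inverts a power of `s_i s_j`, if the exponent of `i` and `j` is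
infinite. If it did, with `a` the power one would have `a s_k a = s_k`. Comparing the `k`-th
coordinates of the images of the `i`-th simple root shows that the `k`-th coroot vanishes on the sum
of the `i`-th and `j`-th simple roots. Its values at the two roots are nonpositive, hence both zero,
and then `a s_k a` moves the `i`-th simple root while `s_k` does not. -/
theorem simple_mul_pow_mul_simple_ne {i j k : B} (h : M i j = 0) (hi : i ≠ k) (hj : j ≠ k) {n : ℕ}
    (hn : 0 < n) : cs.simple k * (cs.simple i * cs.simple j) ^ n * cs.simple k ≠
      ((cs.simple i * cs.simple j) ^ n)⁻¹ := by
  intro hinv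
  set a := (cs.simple i * cs.simple j) ^ n with ha
  have hn' : (0 : ℝ) < n := by exact_mod_cast hn
  have hij : i ≠ j := by rintro rfl; simp at h
  set p := M.simpleCoroot k (Finsupp.single i 1) with hp
  set q := M.simpleCoroot k (Finsupp.single j 1) with hq
  have hp0 : p ≤ 0 := M.simpleCoroot_single_nonpos hi.symm
  have hq0 : q ≤ 0 := M.simpleCoroot_single_nonpos hj.symm
  have haka : a * cs.simple k * a = cs.simple k := by
    calc a * cs.simple k * a = cs.simple k * (cs.simple k * a * cs.simple k * a) := by
          simp [mul_assoc]
      _ = cs.simple k := by rw [hinv, inv_mul_cancel, mul_one]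
  have hrep := congrArg (fun w => cs.geomRep w (Finsupp.single i 1)) haka
  simp only [map_mul, LinearEquiv.mul_apply] at hrep
  rw [ha, cs.geomRep_simple_mul_simple_pow h, ← ha, geomRep_simple, geomRep_simple,
    map_add (M.simpleCoroot k), map_smul (M.simpleCoroot k), map_add (M.simpleCoroot k),
    ← hp, ← hq] at hrep
  have hk := DFunLike.congr_fun hrep k
  rw [ha, cs.geomRep_simple_mul_simple_pow_apply hi hj] at hk
  have hpq : n * (p + q) = 0 := by
    simp [Finsupp.single_eq_of_ne hi.symm, Finsupp.single_eq_of_ne hj.symm, -mul_eq_zero] at hk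
    linarith
  replace hpq : p + q = 0 := (mul_eq_zero.1 hpq).resolve_left hn'.ne'
  have hp' : p = 0 := by linarith
  have hq' : q = 0 := by linarith
  rw [hp', hq'] at hrep
  simp only [add_zero, smul_zero, zero_smul, sub_zero] at hrep
  rw [map_add, map_smul, ha, cs.geomRep_simple_mul_simple_pow h,
    cs.geomRep_simple_mul_simple_pow_add h] at hrep
  have hi' := DFunLike.congr_fun hrep i
  simp [hij.symm] at hi'
  linarith

end CoxeterSystem

/-! ### Translations fixed by a simple reflection -/

/-- The orders of the torsion elements of a finitely generated abelian group are bounded. -/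
theorem CommGroup.exists_pow_eq_one_of_isOfFinOrder (A : Type*) [CommGroup A] [Group.FG A] :
    ∃ n > 0, ∀ a : A, IsOfFinOrder a → a ^ n = 1 := by
  have : AddGroup.FG (Additive A) := inferInstance
  have : Module.Finite ℤ (Additive A) := Module.Finite.iff_addGroup_fg.2 this
  let T := Submodule.torsion ℤ (Additive A)
  have : Finite T := Module.finite_of_fg_torsion T Submodule.torsion_isTorsion
  refine ⟨Nat.card T, Nat.card_pos, fun a ha => ?_⟩
  obtain ⟨k, hk, hak⟩ := isOfFinOrder_iff_pow_eq_one.1 ha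
  have haT : Additive.ofMul a ∈ T := (Submodule.mem_torsion_iff _).2
    ⟨⟨(k : ℤ), mem_nonZeroDivisors_of_ne_zero (by exact_mod_cast hk.ne')⟩, by
      rw [Submonoid.mk_smul, natCast_zsmul, ← ofMul_pow, hak, ofMul_one]⟩
  exact congrArg Subtype.val (card_nsmul_eq_zero' (G := T) (x := ⟨_, haT⟩))

/-- A virtually abelian group has an abelian normal subgroup of finite index. -/
theorem IsVirtuallyAbelian.exists_normal {W : Type*} [Group W] (h : IsVirtuallyAbelian W) :
    ∃ A : Subgroup W, A.Normal ∧ A.FiniteIndex ∧ ∀ a ∈ A, ∀ b ∈ A, a * b = b * a := by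
  obtain ⟨A, hA, hab⟩ := h
  exact ⟨A.normalCore, inferInstance, inferInstance, fun a ha b hb =>
    hab a (A.normalCore_le ha) b (A.normalCore_le hb)⟩

namespace CoxeterSystem

variable {B W : Type*} [Group W] {M : CoxeterMatrix B} (cs : CoxeterSystem M W)

theorem group_fg (cs : CoxeterSystem M W) [Finite B] : Group.FG W :=
  Group.fg_iff.2 ⟨_, cs.subgroup_closure_range_simple, Set.finite_range _⟩

theorem wordProd_mem_closure_of_even : ∀ ω : List B, Even ω.length →
    cs.wordProd ω ∈ Subgroup.closure (Set.range fun p : B × B => cs.simple p.1 * cs.simple p.2)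
  | [], _ => by simp
  | [_], h => by simp at h
  | i :: j :: ω, h => by
    rw [wordProd_cons, wordProd_cons, ← mul_assoc]
    refine mul_mem (Subgroup.subset_closure ⟨(i, j), rfl⟩) (wordProd_mem_closure_of_even ω ?_)
    simpa [Nat.even_add_one] using h

/-- The square of every element is a product of an even number of simple reflections. -/
theorem sq_mem_closure (w : W) :
    w ^ 2 ∈ Subgroup.closure (Set.range fun p : B × B => cs.simple p.1 * cs.simple p.2) := by
  obtain ⟨ω, rfl⟩ := cs.wordProd_surjective w
  rw [pow_two, ← wordProd_append]
  exact cs.wordProd_mem_closure_of_even _ (by simp)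

/-- If all exponents are finite and all simple reflections invert the `n`-th powers of elements of
an abelian subgroup `A` of finite index, then `A` is a torsion group: the powers `a ^ n` are central
in the group of words of even length, and the transfer to `A` maps this group, generated by the
torsion elements `s_i s_j`, to torsion elements, but it is a power map on `a ^ (2 * n)`. -/
theorem isOfFinOrder_of_forall_inverted (hM : ∀ i j, M i j ≠ 0) (A : Subgroup W) [A.FiniteIndex]
    (hA : ∀ a ∈ A, ∀ b ∈ A, a * b = b * a) {n : ℕ} (hn : 0 < n)
    (h : ∀ a ∈ A, ∀ i, cs.simple i * a ^ n * cs.simple i = (a ^ n)⁻¹) {a : W} (ha : a ∈ A) :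
    IsOfFinOrder a := by
  let P := Subgroup.closure (Set.range fun p : B × B => cs.simple p.1 * cs.simple p.2)
  let : CommGroup A := { (inferInstance : Group A) with
    mul_comm := fun a b => Subtype.ext (hA a a.2 b b.2) }
  let ι : A.subgroupOf P →* A :=
    { toFun := fun x => ⟨x.1.1, x.2⟩, map_one' := rfl, map_mul' := fun _ _ => rfl }
  let τ : P →* A := MonoidHom.transfer ι
  have hτ (x : P) : IsOfFinOrder (τ x) := by
    obtain ⟨x, hx⟩ := x
    induction hx using Subgroup.closure_induction with
    | mem x hx =>
      obtain ⟨p, rfl⟩ := hx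
      refine MonoidHom.isOfFinOrder τ (isOfFinOrder_iff_pow_eq_one.2
        ⟨M p.1 p.2, Nat.pos_of_ne_zero (hM _ _), Subtype.ext (cs.simple_mul_simple_pow _ _)⟩)
    | one => exact (map_one τ).symm ▸ IsOfFinOrder.one
    | mul x y hx hy h1 h2 =>
      have := h1.mul h2
      rwa [← map_mul] at this
    | inv x hx h1 =>
      have := h1.inv
      rwa [← map_inv] at this
  -- Squaring makes `a ^ n` a word of even length, so that the transfer applies to it.
  have hcomm (x : W) (hx : x ∈ P) : Commute x ((a ^ n) ^ 2) := by
    refine Commute.pow_right ?_ 2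
    induction hx using Subgroup.closure_induction with
    | mem x hx =>
      obtain ⟨p, rfl⟩ := hx
      have h2 (i : B) : cs.simple i * a ^ n = (a ^ n)⁻¹ * cs.simple i := by
        rw [← h a ha i, simple_mul_simple_cancel_right]
      have h3 (i : B) : cs.simple i * (a ^ n)⁻¹ = a ^ n * cs.simple i := by
        rw [← h a ha i, ← mul_assoc, simple_mul_simple_cancel_left]
      change _ * _ * _ = _ * (_ * _)
      rw [mul_assoc, h2, ← mul_assoc, h3, mul_assoc]
    | one => exact Commute.one_left _
    | mul x y _ _ h1 h2 => exact h1.mul_left h2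
    | inv x _ h1 => exact h1.inv_left
  let d : P := ⟨(a ^ n) ^ 2, cs.sq_mem_closure _⟩
  have hd : τ d = ι _ := MonoidHom.transfer_eq_pow ι d fun k x _ => by
    have : Commute x d := Subtype.ext (hcomm x.1 x.2)
    rw [mul_assoc, ← (this.pow_right k).eq, inv_mul_cancel_left]
  have hfin := hτ d
  rw [hd] at hfin
  replace hfin := MonoidHom.isOfFinOrder A.subtype hfin
  change IsOfFinOrder (((a ^ n) ^ 2) ^ (A.subgroupOf P).index) at hfin
  rw [← pow_mul, ← pow_mul, isOfFinOrder_pow] at hfin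
  refine hfin.resolve_right ?_
  have : (A.subgroupOf P).index ≠ 0 := Subgroup.FiniteIndex.index_ne_zero
  positivity

/-- If there are at least three generators, some simple reflection `s` fixes an element of infinite
order of `A`: the elements `a * s a s` are fixed by `s`. If they were all of finite order, some
power map would send `A` to elements inverted by all simple reflections. This is impossible both if
some exponent is infinite and if none is. -/
theorem exists_commute_not_isOfFinOrder [Finite B] [Infinite W] (hB : 3 ≤ Nat.card B)
    (A : Subgroup W) [A.Normal] [A.FiniteIndex] (hA : ∀ a ∈ A, ∀ b ∈ A, a * b = b * a) :
    ∃ i, ∃ t ∈ A, ¬ IsOfFinOrder t ∧ t * cs.simple i = cs.simple i * t := by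
  by_contra! hcon
  have := cs.group_fg
  let : CommGroup A := { (inferInstance : Group A) with
    mul_comm := fun a b => Subtype.ext (hA a a.2 b b.2) }
  have hfg : Group.FG A := A.fg_of_index_ne_zero
  obtain ⟨n, hn, htors⟩ := CommGroup.exists_pow_eq_one_of_isOfFinOrder A
  have hinv (a : W) (ha : a ∈ A) (i : B) :
      cs.simple i * a ^ n * cs.simple i = (a ^ n)⁻¹ := by
    have hsA : cs.simple i * a * cs.simple i ∈ A := by
      simpa using ‹A.Normal›.conj_mem a ha (cs.simple i)
    have hmem : a * (cs.simple i * a * cs.simple i) ∈ A := mul_mem ha hsA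
    have hcomm : Commute a (cs.simple i * a * cs.simple i) := hA _ ha _ hsA
    have hfin : IsOfFinOrder (a * (cs.simple i * a * cs.simple i)) := by
      by_contra hinf
      refine hcon i _ hmem hinf ?_
      have h1 : a * (cs.simple i * a * cs.simple i) * cs.simple i = a * cs.simple i * a := by
        simp [mul_assoc]
      rw [h1, hcomm.eq]
      simp [mul_assoc]
    have h1 := congrArg Subtype.val (htors ⟨_, hmem⟩ (Submonoid.isOfFinOrder_coe.1 hfin))
    have h2 : (a * (cs.simple i * a * cs.simple i)) ^ n = 1 := h1
    rw [hcomm.mul_pow] at h2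
    have h3 : (cs.simple i * a * cs.simple i) ^ n = cs.simple i * a ^ n * cs.simple i := by
      simpa using conj_pow (i := n) (a := cs.simple i) (b := a)
    rw [← h3]
    exact eq_inv_of_mul_eq_one_right h2
  by_cases hM : ∀ i j, M i j ≠ 0
  · have : Infinite A := by
      by_contra hfin
      rw [not_infinite_iff_finite] at hfin
      exact not_finite_iff_infinite.2 ‹Infinite W›
        (A.finite_iff_finite_and_finiteIndex.2 ⟨hfin, inferInstance⟩)
    refine not_finite_iff_infinite.2 this (CommGroup.finite_of_fg_isMulTorsion A fun a => ?_)
    exact Submonoid.isOfFinOrder_coe.1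
      (cs.isOfFinOrder_of_forall_inverted hM A hA hn hinv a.2)
  · push Not at hM
    obtain ⟨i, j, hij⟩ := hM
    obtain ⟨k, hk⟩ : ∃ k, k ∉ ({i, j} : Set B) := by
      by_contra! hall
      have h1 : (Set.univ : Set B).ncard ≤ ({i, j} : Set B).ncard :=
        Set.ncard_le_ncard (fun x _ => hall x) (Set.toFinite _)
      have h2 := Set.ncard_insert_le i {j}
      rw [Set.ncard_univ] at h1
      rw [Set.ncard_singleton] at h2
      omega
    simp only [Set.mem_insert_iff, Set.mem_singleton_iff, not_or] at hk
    have h0 : A.index ≠ 0 := Subgroup.FiniteIndex.index_ne_zero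
    refine cs.simple_mul_pow_mul_simple_ne hij (Ne.symm hk.1) (Ne.symm hk.2)
      (n := A.index * n) (by positivity) ?_
    rw [pow_mul]
    exact hinv _ (A.pow_index_mem _) k

end CoxeterSystem

/-! ### The infinite dihedral group -/

namespace DihedralGroup

/-- The integers modulo `0` are the integers. -/
def zmodZeroEquiv : ZMod 0 ≃+* ℤ := RingEquiv.refl ℤ

/-- The position of an element of the infinite dihedral group on the line that is its Cayley graph
with respect to `sr 0` and `sr 1`. -/
def position : DihedralGroup 0 → ℤ
  | r k => 2 * zmodZeroEquiv k
  | sr k => 1 - 2 * zmodZeroEquiv k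

theorem position_injective : Function.Injective position := by
  rintro (a | a) (b | b) h <;> simp only [position] at h
  · exact congrArg r (zmodZeroEquiv.injective (by omega))
  · omega
  · omega
  · exact congrArg sr (zmodZeroEquiv.injective (by omega))

theorem natAbs_position_inv_mul (x y : DihedralGroup 0) :
    (position (x⁻¹ * y)).natAbs = (position x - position y).natAbs := by
  rcases x with a | a <;> rcases y with b | b
  · rw [inv_r, r_mul_r]
    simp only [position, map_add, map_neg]
    omega
  · rw [inv_r, r_mul_sr]
    simp only [position, map_sub, map_neg]
    omega
  · rw [inv_sr, sr_mul_r]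
    simp only [position, map_add]
    omega
  · rw [inv_sr, sr_mul_sr]
    simp only [position, map_sub]
    omega

/-- The involutions of the infinite dihedral group are the elements `sr a`, and `sr a` commutes
only with itself and the identity. -/
theorem finite_centralizer_of_sq_eq_one {x : DihedralGroup 0} (hx : x ≠ 1) (hx2 : x * x = 1) :
    {w : DihedralGroup 0 | x * w = w * x}.Finite := by
  have two_mul_eq_zero (a : ZMod 0) (h : a + a = 0) : a = 0 := by
    have h' := congrArg zmodZeroEquiv h
    rw [map_add, map_zero] at h'
    exact zmodZeroEquiv.injective (by rw [map_zero]; omega)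
  rcases x with a | a
  · rw [r_mul_r, one_def, r.injEq] at hx2
    rw [two_mul_eq_zero a hx2] at hx
    exact absurd rfl hx
  · refine (Set.toFinite {1, sr a}).subset ?_
    rintro (b | b) hb
    · rw [Set.mem_ofPred_eq, sr_mul_r, r_mul_sr, sr.injEq] at hb
      rw [two_mul_eq_zero b (by linear_combination hb)]
      exact Or.inl rfl
    · rw [Set.mem_ofPred_eq, sr_mul_sr, sr_mul_sr, r.injEq] at hb
      have := two_mul_eq_zero (b - a) (by linear_combination hb)
      rw [sub_eq_zero.1 this]
      exact Or.inr rfl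

end DihedralGroup

namespace CoxeterSystem

open RootedGraph DihedralGroup

variable {B W : Type*} [Group W] {M : CoxeterMatrix B} (cs : CoxeterSystem M W)

/-- In rank at most two every element is a power of `s t`, up to multiplication by `s`. -/
theorem exists_zpow_or_zpow_mul {i j : B} (hB : ∀ k, k = i ∨ k = j) (w : W) :
    ∃ n : ℤ, w = (cs.simple i * cs.simple j) ^ n ∨
      w = (cs.simple i * cs.simple j) ^ n * cs.simple i := by
  induction w using cs.simple_induction_right with
  | one => exact ⟨0, by simp⟩
  | mul_simple_right w k ih =>
    have hj : cs.simple j = (cs.simple i * cs.simple j)⁻¹ * cs.simple i := by simp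
    have hj' : cs.simple i * cs.simple j = (cs.simple i * cs.simple j) ^ (1 : ℤ) := by simp
    obtain ⟨n, rfl | rfl⟩ := ih <;> rcases hB k with rfl | rfl
    · exact ⟨n, Or.inr rfl⟩
    · refine ⟨n - 1, Or.inr ?_⟩
      rw [zpow_sub_one, mul_assoc, ← hj]
    · exact ⟨n, Or.inl (by simp)⟩
    · refine ⟨n + 1, Or.inl ?_⟩
      rw [zpow_add_one, mul_assoc]

theorem finite_of_rank_le_two (cs : CoxeterSystem M W) {i j : B} (hB : ∀ k, k = i ∨ k = j)
    (hM : M i j ≠ 0) : Finite W := by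
  have hfin : IsOfFinOrder (cs.simple i * cs.simple j) := isOfFinOrder_iff_pow_eq_one.2
    ⟨M i j, Nat.pos_of_ne_zero hM, cs.simple_mul_simple_pow i j⟩
  have h1 : (Subgroup.zpowers (cs.simple i * cs.simple j) : Set W).Finite :=
    hfin.finite_zpowers
  refine Set.finite_univ_iff.1 ((h1.union (h1.image (· * cs.simple i))).subset fun w _ => ?_)
  obtain ⟨n, h | h⟩ := cs.exists_zpow_or_zpow_mul hB w
  · exact Or.inl ⟨n, h.symm⟩
  · exact Or.inr ⟨_, ⟨n, rfl⟩, h.symm⟩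

/-- The isomorphism of the infinite dihedral Coxeter group with the group of symmetries of a line,
matching the two simple reflections with `sr 0` and `sr 1`. -/
theorem exists_mulEquiv_dihedralGroup {i j : B} (hij : i ≠ j) (hB : ∀ k, k = i ∨ k = j)
    (hM : M i j = 0) :
    ∃ e : W ≃* DihedralGroup 0, e (cs.simple i) = sr 0 ∧ e (cs.simple j) = sr 1 := by
  classical
  let f : B → DihedralGroup 0 := fun k => if k = i then sr 0 else sr 1
  have hf : M.IsLiftable f := by
    intro k l
    rcases eq_or_ne k l with rfl | hkl
    · rw [M.diagonal, pow_one]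
      by_cases h : k = i <;> simp [f, h]
    · have : M k l = 0 := by
        rcases hB k with rfl | rfl <;> rcases hB l with rfl | rfl
        · exact absurd rfl hkl
        · exact hM
        · rw [M.symmetric]; exact hM
        · exact absurd rfl hkl
      rw [this, pow_zero]
  let φ : W →* DihedralGroup 0 := cs.lift ⟨f, hf⟩
  have hi : φ (cs.simple i) = sr 0 := by simp [φ, lift_apply_simple, f]
  have hj : φ (cs.simple j) = sr 1 := by simp [φ, lift_apply_simple, f, hij.symm]
  have hpow (n : ℤ) : φ ((cs.simple i * cs.simple j) ^ n) = r (Int.cast n : ZMod 0) := by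
    rw [map_zpow, map_mul, hi, hj, sr_mul_sr, sub_zero, r_one_zpow]
  refine ⟨MulEquiv.ofBijective φ ⟨(injective_iff_map_eq_one φ).2 fun w hw => ?_, fun x => ?_⟩,
    hi, hj⟩
  · obtain ⟨n, rfl | rfl⟩ := cs.exists_zpow_or_zpow_mul hB w
    · rw [hpow, DihedralGroup.one_def, r.injEq] at hw
      rw [show n = 0 by simpa using congrArg zmodZeroEquiv hw, zpow_zero]
    · rw [map_mul, hpow, hi, r_mul_sr, DihedralGroup.one_def] at hw
      cases hw
  · rcases x with k | k <;> obtain ⟨k, rfl⟩ := ZMod.intCast_surjective k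
    · exact ⟨_, hpow k⟩
    · refine ⟨(cs.simple i * cs.simple j) ^ (-k) * cs.simple i, ?_⟩
      rw [map_mul, hpow, hi, r_mul_sr, Int.cast_neg, zero_sub, neg_neg]


/-- Under an isomorphism matching the simple reflections with `sr 0` and `sr 1`, the length of an
element is the distance of its position from the origin. -/
theorem length_eq_natAbs_position {i j : B} (hB : ∀ k, k = i ∨ k = j) (e : W ≃* DihedralGroup 0)
    (hi : e (cs.simple i) = sr 0) (hj : e (cs.simple j) = sr 1) (w : W) :
    cs.length w = (position (e w)).natAbs := by
  have p0 : position (sr 0) = 1 := rfl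
  have p1 : position (sr 1) = -1 := rfl
  have hstep (k : B) (w : W) : (position (e w) - position (e (w * cs.simple k))).natAbs = 1 := by
    rw [← natAbs_position_inv_mul, ← map_inv, ← map_mul, inv_mul_cancel_left]
    rcases hB k with rfl | rfl
    · rw [hi, p0]; rfl
    · rw [hj, p1]; rfl
  apply le_antisymm
  · -- the two neighbours of `w` lie at distinct positions, so one is closer to the origin
    induction hm : (position (e w)).natAbs generalizing w with
    | zero =>
      have : position (e w) = position 1 := Int.natAbs_eq_zero.1 hm
      have : w = 1 := by simpa using position_injective this
      simp [this]
    | succ m ih =>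
      have hne : position (e (w * cs.simple i)) ≠ position (e (w * cs.simple j)) := fun h => by
        have := position_injective h
        simp only [map_mul, hi, hj, mul_right_inj, sr.injEq] at this
        exact absurd this (by decide)
      have h1 := hstep i w
      have h2 := hstep j w
      obtain ⟨k, hk⟩ : ∃ k, (position (e (w * cs.simple k))).natAbs = m := by
        by_cases h : (position (e (w * cs.simple i))).natAbs = m
        · exact ⟨i, h⟩
        · exact ⟨j, by omega⟩
      have := ih _ hk
      have := cs.length_mul_simple w k
      omega
  · obtain ⟨ω, hω, rfl⟩ := cs.exists_isReduced w
    rw [hω.eq]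
    clear hω
    induction ω using List.reverseRecOn with
    | nil => simp; rfl
    | append_singleton ω k ih =>
      have := hstep k (cs.wordProd ω)
      rw [wordProd_append, wordProd_singleton, List.length_append, List.length_singleton]
      omega

/-- The Cayley graph of the infinite dihedral system is a line. If a net goes to infinity, right
multiplication by `h` moves its positions by a bounded amount, so that it does not change which
elements are eventually below. -/
theorem IsInfiniteDihedral.smallAtInfinity {cs : CoxeterSystem M W} (h : cs.IsInfiniteDihedral) :
    cs.SmallAtInfinity := by
  obtain ⟨i, j, hij, hB, hM⟩ := h
  obtain ⟨e, hi, hj⟩ := cs.exists_mulEquiv_dihedralGroup hij hB hM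
  have hlen := cs.length_eq_natAbs_position hB e hi hj
  have hdist (x y : W) :
      cs.length (x⁻¹ * y) = (position (e x) - position (e y)).natAbs := by
    rw [hlen, map_mul, map_inv, natAbs_position_inv_mul]
  intro z hz l hl g
  refine tendsto_vertex_iff.2 fun x => ?_
  have hfar (n : ℕ) : ∀ᶠ w in l, n < (position (e w)).natAbs := by
    have hfin : {w : W | (position (e w)).natAbs ≤ n}.Finite := by
      refine Set.Finite.of_finite_image (f := fun w => position (e w))
        ((Set.finite_Icc (-n : ℤ) n).subset ?_)
        (position_injective.comp e.injective).injOn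
      rintro _ ⟨w, hw, rfl⟩
      have : (position (e w)).natAbs ≤ n := hw
      change -(n : ℤ) ≤ position (e w) ∧ position (e w) ≤ n
      omega
    have := (eventually_all_finite hfin).2 fun w _ => eventually_ne_of_tendsto_vertex hz hl w
    filter_upwards [this] with w hw
    by_contra hle
    exact hw w (not_lt.1 hle) rfl
  filter_upwards [tendsto_vertex_iff.1 hl x, hfar (cs.length x + cs.length g)] with w hw hwl
  rw [← hw, below_iff, below_iff, hdist, hdist]
  have h1 := hdist w (w * g)
  rw [inv_mul_cancel_left] at h1
  rw [hlen (w * g), hlen w]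
  rw [hlen x] at hwl ⊢
  omega

end CoxeterSystem

/-! ### Irreducible affine systems -/

namespace CoxeterSystem

variable {B W : Type*} [Group W] {M : CoxeterMatrix B} (cs : CoxeterSystem M W)

/-- In rank at least three, a simple reflection commutes with a translation of infinite order. -/
theorem IsIrreducibleAffine.exists_commute_translation {cs : CoxeterSystem M W}
    (haff : cs.IsIrreducibleAffine) (hB : 3 ≤ Nat.card B) : ∃ i : B,
      (∃ A : Subgroup W, A.Normal ∧ A.FiniteIndex ∧ (∀ a ∈ A, ∀ b ∈ A, a * b = b * a) ∧
        ∃ t ∈ A, ¬ IsOfFinOrder t ∧ t * cs.simple i = cs.simple i * t) ∧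
      {w : W | cs.simple i * w = w * cs.simple i}.Infinite := by
  have := haff.finite_rank
  have := haff.infinite
  obtain ⟨A, hn, hfi, hA⟩ := haff.virtuallyAbelian.exists_normal
  obtain ⟨i, t, htA, ht, hti⟩ := cs.exists_commute_not_isOfFinOrder hB A hA
  refine ⟨i, ⟨A, hn, hfi, hA, t, htA, ht, hti⟩, ?_⟩
  refine Set.infinite_of_injective_forall_mem (f := fun n : ℕ => t ^ n)
    (injective_pow_iff_not_isOfFinOrder.2 ht) fun n => ?_
  exact ((show Commute t (cs.simple i) from hti).pow_left n).eq.symm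

/-- A connected diagram with at most two vertices, of an infinite group, is the infinite dihedral
one. -/
theorem IsIrreducibleAffine.isInfiniteDihedral {cs : CoxeterSystem M W}
    (haff : cs.IsIrreducibleAffine) (hB : ¬ 3 ≤ Nat.card B) : cs.IsInfiniteDihedral := by
  have := haff.finite_rank
  have hinf := not_finite_iff_infinite.2 haff.infinite
  obtain ⟨i⟩ := haff.irreducible.nonempty
  by_cases hsub : ∀ k, k = i
  · exact absurd (cs.finite_of_rank_le_two (fun k => Or.inl (hsub k)) (by simp : M i i ≠ 0)) hinf
  push Not at hsub
  obtain ⟨j, hji⟩ := hsub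
  have hall (k : B) : k = i ∨ k = j := by
    by_contra! hk
    refine hB ?_
    have hcard : ({i, j, k} : Set B).ncard = 3 :=
      Set.ncard_eq_three.2 ⟨i, j, k, hji.symm, hk.1.symm, hk.2.symm, rfl⟩
    rw [← hcard, ← Set.ncard_univ]
    exact Set.ncard_le_ncard (Set.subset_univ _) (Set.toFinite _)
  refine ⟨i, j, hji.symm, hall, ?_⟩
  by_contra hM
  exact hinf (cs.finite_of_rank_le_two hall hM)

end CoxeterSystem

theorem mainTheorem11 {B W : Type*} [Group W] {M : CoxeterMatrix B} (cs : CoxeterSystem M W)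
    (haff : cs.IsIrreducibleAffine) :
    (cs.SmallAtInfinity ↔ cs.IsInfiniteDihedral) ∧
    (cs.SmallAtInfinity ↔ Nonempty (W ≃* DihedralGroup 0)) ∧
    (3 ≤ Nat.card B → ∃ i : B,
      (∃ A : Subgroup W, A.Normal ∧ A.FiniteIndex ∧ (∀ a ∈ A, ∀ b ∈ A, a * b = b * a) ∧
        ∃ t ∈ A, ¬ IsOfFinOrder t ∧ t * cs.simple i = cs.simple i * t) ∧
      {w : W | cs.simple i * w = w * cs.simple i}.Infinite) := by
  have := haff.finite_rank
  have h1 : cs.SmallAtInfinity → cs.IsInfiniteDihedral := fun hs =>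
    haff.isInfiniteDihedral fun hB => by
      obtain ⟨i, -, hi⟩ := haff.exists_commute_translation hB
      exact cs.not_smallAtInfinity_of_infinite_centralizer hi hs
  have h2 : Nonempty (W ≃* DihedralGroup 0) → cs.IsInfiniteDihedral := fun ⟨e⟩ =>
    haff.isInfiniteDihedral fun hB => by
      obtain ⟨i, -, hi⟩ := haff.exists_commute_translation hB
      have hfin := DihedralGroup.finite_centralizer_of_sq_eq_one (x := e (cs.simple i))
        (by simpa using cs.simple_ne_one i) (by rw [← map_mul, cs.simple_mul_simple_self, map_one])
      refine hi ((hfin.preimage e.injective.injOn).subset fun w hw => ?_)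
      change e _ * e w = e w * e _
      rw [← map_mul, ← map_mul, show cs.simple i * w = w * cs.simple i from hw]
  refine ⟨⟨h1, fun h => h.smallAtInfinity⟩, ⟨fun hs => ?_, fun he => (h2 he).smallAtInfinity⟩,
    haff.exists_commute_translation⟩
  obtain ⟨i, j, hij, hall, hM⟩ := h1 hs
  obtain ⟨e, -⟩ := cs.exists_mulEquiv_dihedralGroup hij hall hM
  exact ⟨e⟩
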